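/- Let $m,n\ge 1$ and let $\sigma=(\sigma_1,\dots,\sigma_m)$ and $\rho=(\rho_1,\dots,\rho_n)$ be vectors of positive real numbers with $\sigma_1\ge\dots\ge\sigma_m$, $\rho_1\ge\dots\ge\rho_n$ and $\sum_{j}\sigma_j=\sum_{i}\rho_i=1$. For $x\in\mathbb R^m$ and $y\in\mathbb R^n$ put $|x|_\sigma=\max_{j}|x_j|^{1/\sigma_j}$ and $|y|_\rho=\max_{i}|y_i|^{1/\rho_i}$. Let $\Theta\in\mathbb R^{n\times m}$. Let $\omega=\omega_{\sigma,\rho}(\Theta)$ be the supremum (in the extended reals) of the real $\gamma$ such that for arbitrarily large $t$ the system $|x|_\sigma\le t$, $|\Theta x-y|_\rho\le t^{-\gamma}$ has a nonzero solution $(x,y)\in\mathbb Z^{m}\times\mathbb Z^n$. For $\eta\in\mathbb R^n$ let $\hat\omega_{\sigma,\rho}(\Theta,\eta)$ be the supremum (in the extended reals) of the real $\gamma$ such that for every sufficiently large $t$ the system $|x|_\sigma\le t$, $|\Theta x-y-\eta|_\rho\le t^{-\gamma}$ has a nonzero solution $(x,y)\in\mathbb Z^{m}\times\mathbb Z^n$.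 Suppose that $\omega<(1-\rho_n)^{-1}$, where $(1-\rho_n)^{-1}$ is understood as $+\infty$ if $\rho_n=1$. Then, for every $\eta\in\mathbb R^n$, $$\hat\omega_{\sigma,\rho}(\Theta,\eta)\ \ge\ \frac{\sigma_m}{\rho_n}\cdot\frac{1-(1-\rho_n)\,\omega}{\omega-(1-\sigma_m)}.$$ -/

import Mathlib

open Filter

/-- The weighted norm `|x|_σ = max_j |x_j|^(1/σ_j)` of a real vector. -/
noncomputable def weightedNorm {k : ℕ} (σ : Fin k → ℝ) (x : Fin k → ℝ) : ℝ :=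
  ⨆ j, |x j| ^ (1 / σ j)

/-- The weight vectors of the weighted setting: positive, non-increasing, of sum one. -/
structure IsWeight {k : ℕ} (σ : Fin k → ℝ) : Prop where
  pos : ∀ j, 0 < σ j
  antitone : Antitone σ
  sum_eq_one : ∑ j, σ j = 1

/-- The system `|x|_σ ≤ t`, `|Θ x - y - η|_ρ ≤ t ^ (-γ)` has a nonzero solution
`(x, y) ∈ ℤ^(m+n)`. -/
def InhomogeneousSolvable {m n : ℕ} (σ : Fin m → ℝ) (ρ : Fin n → ℝ)
    (Θ : Matrix (Fin n) (Fin m) ℝ) (η : Fin n → ℝ) (γ t : ℝ) : Prop :=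
  ∃ (x : Fin m → ℤ) (y : Fin n → ℤ), (x, y) ≠ 0 ∧
    weightedNorm σ (fun j => (x j : ℝ)) ≤ t ∧
    weightedNorm ρ (fun i => Θ.mulVec (fun j => (x j : ℝ)) i - (y i : ℝ) - η i) ≤ t ^ (-γ)

/-- The system `|x|_σ ≤ t`, `|Θ x - y|_ρ ≤ t ^ (-γ)` has a nonzero solution
`(x, y) ∈ ℤ^(m+n)`. -/
def HomogeneousSolvable {m n : ℕ} (σ : Fin m → ℝ) (ρ : Fin n → ℝ)
    (Θ : Matrix (Fin n) (Fin m) ℝ) (γ t : ℝ) : Prop :=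
  ∃ (x : Fin m → ℤ) (y : Fin n → ℤ), (x, y) ≠ 0 ∧
    weightedNorm σ (fun j => (x j : ℝ)) ≤ t ∧
    weightedNorm ρ (fun i => Θ.mulVec (fun j => (x j : ℝ)) i - (y i : ℝ)) ≤ t ^ (-γ)

/-- The weighted Diophantine exponent `ω_{σ,ρ}(Θ)`: the supremum, in the extended reals, of the
real `γ` such that the homogeneous system has nonzero solutions for arbitrarily large `t`. -/
noncomputable def weightedExponent {m n : ℕ} (σ : Fin m → ℝ) (ρ : Fin n → ℝ)
    (Θ : Matrix (Fin n) (Fin m) ℝ) : EReal :=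
  sSup ((fun γ : ℝ => (γ : EReal)) '' {γ : ℝ | ∃ᶠ t in atTop, HomogeneousSolvable σ ρ Θ γ t})

/-- The inhomogeneous uniform weighted Diophantine exponent `ω̂_{σ,ρ}(Θ,η)`: the supremum, in the
extended reals, of the real `γ` such that the inhomogeneous system has nonzero solutions for
every sufficiently large `t`. -/
noncomputable def uniformInhomogeneousExponent {m n : ℕ} (σ : Fin m → ℝ) (ρ : Fin n → ℝ)
    (Θ : Matrix (Fin n) (Fin m) ℝ) (η : Fin n → ℝ) : EReal :=
  sSup ((fun γ : ℝ => (γ : EReal)) '' {γ : ℝ | ∀ᶠ t in atTop, InhomogeneousSolvable σ ρ Θ η γ t})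

/-- The extended real number `(1 - r)⁻¹`, with the convention `(1 - 1)⁻¹ = +∞`. -/
noncomputable def invOneSub (r : ℝ) : EReal :=
  if r = 1 then ⊤ else (((1 - r)⁻¹ : ℝ) : EReal)

/-! The theorem is a transference from the absence of small homogeneous solutions to the presence of
inhomogeneous ones. If a box of half-sides `c k` contains no nonzero point of a unimodular lattice,
then every point lies within `2 / ∏ c` times that box of the lattice
(`exists_int_forall_abs_sub_le`). For `γ` slightly above `ω`, the box `T ^ σ j`, `T ^ (-γ * ρ i)` is
free of nonzero lattice points for all large `T`, and the dilation factor is `2 * T ^ (γ - 1)`.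
Taking `T = t ^ s`, the dilated box fits into the inhomogeneous system with exponent `δ` once `s`
satisfies one inequality per coordinate. The smallest weights `σm` and `ρn` give the binding ones,
and a suitable `s` exists when `δ` is below the stated bound with `γ` for `ω`. -/

/-! ### Packing and covering by boxes modulo a unimodular lattice -/

-- Blichfeldt's principle for the boxes of sides `c k` centred at the `p i`: if their total volume
-- exceeded the covolume 1, two points of their union would differ by a nonzero lattice vector. In a
-- single box this contradicts `hmin`, in two boxes `hp`.
open MeasureTheory in
theorem card_mul_prod_le_one_of_separated {ι : Type*} [Fintype ι] [DecidableEq ι]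
    (A : Matrix ι ι ℝ) (hA : |A.det| = 1) (c : ι → ℝ) (hc : ∀ k, 0 < c k)
    (hmin : ∀ z : ι → ℤ, z ≠ 0 → ¬ ∀ k, |A.mulVec (fun j => (z j : ℝ)) k| < c k)
    (N : ℕ) (p : Fin N → ι → ℝ)
    (hp : ∀ i j, i ≠ j → ¬ ∃ z : ι → ℤ, ∀ k,
      |p j k - p i k - A.mulVec (fun l => (z l : ℝ)) k| < c k) :
    N * ∏ k, c k ≤ 1 := by
  by_contra! hlt
  have hdet : A.det ≠ 0 := by
    intro h
    simp [h] at hA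
  set B : Fin N → Set (ι → ℝ) := fun i =>
    Set.pi Set.univ fun k => Set.Ioo (p i k - c k / 2) (p i k + c k / 2) with hB
  have hmemB : ∀ i x, x ∈ B i ↔ ∀ k, |x k - p i k| < c k / 2 := by
    intro i x
    simp only [hB, Set.mem_pi, Set.mem_univ, true_imp_iff, Set.mem_Ioo, abs_lt]
    refine forall_congr' fun k => ⟨fun h => ⟨?_, ?_⟩, fun h => ⟨?_, ?_⟩⟩ <;> linarith [h.1, h.2]
  have hBmeas : ∀ i, MeasurableSet (B i) := fun i =>
    MeasurableSet.univ_pi fun k => measurableSet_Ioo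
  have hBdisj : Pairwise (Function.onFun Disjoint B) := by
    intro i j hij
    rw [Function.onFun, Set.disjoint_left]
    intro x hi hj
    rw [hmemB] at hi hj
    refine hp i j hij ⟨0, fun k => ?_⟩
    have : A.mulVec (fun l => (((0 : ι → ℤ) l : ℤ) : ℝ)) k = 0 := by
      simp [Matrix.mulVec, dotProduct]
    rw [this]
    have h1 := abs_lt.1 (hi k)
    have h2 := abs_lt.1 (hj k)
    rw [abs_lt]
    constructor <;> linarith [h1.1, h1.2, h2.1, h2.2]
  have hBvol : ∀ i, volume (B i) = ENNReal.ofReal (∏ k, c k) := by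
    intro i
    rw [hB, Real.volume_pi_Ioo, ENNReal.ofReal_prod_of_nonneg fun k _ => (hc k).le]
    refine Finset.prod_congr rfl fun k _ => ?_
    congr 1
    ring
  have hvol : volume ((Matrix.toLin' A) ⁻¹' ⋃ i, B i) = ENNReal.ofReal (N * ∏ k, c k) := by
    rw [Measure.addHaar_preimage_linearMap _ (by rwa [LinearMap.det_toLin']),
      LinearMap.det_toLin', abs_inv, hA, measure_iUnion hBdisj hBmeas]
    simp [hBvol, ENNReal.ofReal_mul]
  set b := Pi.basisFun ℝ ι with hb
  have hF : volume (ZSpan.fundamentalDomain b) = 1 := by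
    rw [ZSpan.volume_fundamentalDomain]
    have : Matrix.of ⇑b = 1 := by
      ext i j
      simp [hb, Matrix.one_apply, Pi.single_apply, eq_comm]
    simp [this]
  have hmeas : MeasurableSet ((Matrix.toLin' A) ⁻¹' ⋃ i, B i) :=
    (LinearMap.continuous_of_finiteDimensional (Matrix.toLin' A)).measurable
      (MeasurableSet.iUnion hBmeas)
  have : Countable (Submodule.span ℤ (Set.range b)).toAddSubgroup :=
    inferInstanceAs (Countable (Submodule.span ℤ (Set.range b)))
  obtain ⟨x, y, hxy, hnd⟩ := exists_pair_mem_lattice_not_disjoint_vadd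
    (ZSpan.isAddFundamentalDomain' b volume) hmeas.nullMeasurableSet (by
      rw [hF, hvol, ← ENNReal.ofReal_one]
      exact (ENNReal.ofReal_lt_ofReal_iff (by linarith)).2 hlt)
  rw [Set.not_disjoint_iff] at hnd
  obtain ⟨v, hvx, hvy⟩ := hnd
  obtain ⟨s, hs, rfl⟩ := hvx
  obtain ⟨s', hs', hss⟩ := hvy
  simp only [AddSubgroup.vadd_def, vadd_eq_add] at hss
  have hint : ((y - x : (Submodule.span ℤ (Set.range b)).toAddSubgroup) : ι → ℝ) ∈
      Submodule.span ℤ (Set.range b) := (y - x).2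
  obtain ⟨z, hz⟩ := (Submodule.mem_span_range_iff_exists_fun _).1 hint
  have hz' : (fun l => (z l : ℝ)) = (y : ι → ℝ) - x := by
    rw [← AddSubgroup.coe_sub, ← hz]
    ext l
    simp [hb, Pi.single_apply]
  have hdiff : s = s' + fun l => (z l : ℝ) := by
    rw [hz']
    ext l
    have := congrFun hss l
    simp only [Pi.add_apply, Pi.sub_apply] at this ⊢
    linarith
  simp only [Set.mem_preimage, Matrix.toLin'_apply, Set.mem_iUnion] at hs hs'
  obtain ⟨i, hi⟩ := hs
  obtain ⟨j, hj⟩ := hs'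
  rw [hmemB] at hi hj
  rw [hdiff, Matrix.mulVec_add] at hi
  have key : ∀ k, |p i k - p j k - A.mulVec (fun l => (z l : ℝ)) k| < c k := by
    intro k
    have h1 := abs_lt.1 (hi k)
    have h2 := abs_lt.1 (hj k)
    rw [Pi.add_apply] at h1
    rw [abs_lt]
    constructor <;> linarith [h1.1, h1.2, h2.1, h2.2]
  by_cases hij : j = i
  · subst hij
    refine hmin z ?_ fun k => by simpa using key k
    rintro rfl
    apply hxy
    ext l
    have := congrFun hz' l
    simp only [Pi.zero_apply, Int.cast_zero, Pi.sub_apply] at this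
    linarith
  · exact hp j i hij ⟨z, key⟩

/-- Join points whose difference lies in the open `c`-box modulo the lattice. A path of length `L`
from `0` to `α` puts `α` within `L * c` of the lattice, and packing bounds the length of a shortest
path. -/
theorem exists_int_forall_abs_sub_le {ι : Type*} [Fintype ι] [DecidableEq ι]
    (A : Matrix ι ι ℝ) (hA : |A.det| = 1) (c : ι → ℝ) (hc : ∀ k, 0 < c k)
    (hmin : ∀ z : ι → ℤ, z ≠ 0 → ¬ ∀ k, |A.mulVec (fun j => (z j : ℝ)) k| < c k)
    (α : ι → ℝ) :
    ∃ z : ι → ℤ, ∀ k, |A.mulVec (fun l => (z l : ℝ)) k - α k| ≤ 2 / (∏ k, c k) * c k := by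
  set near : (ι → ℝ) → (ι → ℝ) → Prop := fun p q =>
    ∃ z : ι → ℤ, ∀ k, |q k - p k - A.mulVec (fun l => (z l : ℝ)) k| < c k
  have hneg : ∀ (z : ι → ℤ), A.mulVec (fun l => ((-z) l : ℝ)) =
      -A.mulVec (fun l => (z l : ℝ)) := by
    intro z
    rw [← Matrix.mulVec_neg]
    congr 1
    ext l
    simp
  have hadd : ∀ (z w : ι → ℤ), A.mulVec (fun l => ((z + w) l : ℝ)) =
      A.mulVec (fun l => (z l : ℝ)) + A.mulVec (fun l => (w l : ℝ)) := by
    intro z w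
    rw [← Matrix.mulVec_add]
    congr 1
    ext l
    simp
  have hzero : A.mulVec (fun l => ((0 : ι → ℤ) l : ℝ)) = 0 := by
    ext k
    simp [Matrix.mulVec, dotProduct]
  have hsymm : ∀ p q, near p q → near q p := by
    rintro p q ⟨z, hz⟩
    refine ⟨-z, fun k => ?_⟩
    have e : p k - q k - A.mulVec (fun l => ((-z) l : ℝ)) k =
        -(q k - p k - A.mulVec (fun l => (z l : ℝ)) k) := by
      have := congrFun (hneg z) k
      simp only [Pi.neg_apply] at this ⊢
      rw [this]
      ring
    rw [e, abs_neg]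
    exact hz k
  let G : SimpleGraph (ι → ℝ) :=
    { Adj := fun p q => p ≠ q ∧ near p q
      symm := ⟨fun p q h => ⟨h.1.symm, hsymm p q h.2⟩⟩
      loopless := ⟨fun p h => h.1 rfl⟩ }
  have hwalk : ∀ (p q : ι → ℝ) (w : G.Walk p q), ∃ z : ι → ℤ, ∀ k,
      |q k - p k - A.mulVec (fun l => (z l : ℝ)) k| ≤ w.length * c k := by
    intro p q w
    induction w with
    | nil => exact ⟨0, fun k => by simpa using congrFun hzero k⟩
    | @cons u v x h w ih =>
      obtain ⟨z, hz⟩ := ih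
      obtain ⟨z', hz'⟩ := h.2
      refine ⟨z + z', fun k => ?_⟩
      have e : x k - u k - A.mulVec (fun l => ((z + z') l : ℝ)) k =
          (x k - v k - A.mulVec (fun l => (z l : ℝ)) k) +
          (v k - u k - A.mulVec (fun l => (z' l : ℝ)) k) := by
        rw [hadd, Pi.add_apply]
        ring
      rw [e, SimpleGraph.Walk.length_cons]
      push_cast
      linarith [abs_add_le (x k - v k - A.mulVec (fun l => (z l : ℝ)) k)
        (v k - u k - A.mulVec (fun l => (z' l : ℝ)) k), hz k, hz' k]
  have hreach : G.Reachable 0 α := by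
    -- Cutting the segment from `0` to `α` into `M` equal steps makes each step shorter than `c`.
    obtain ⟨M, hM⟩ := exists_nat_gt (∑ k, |α k| / c k)
    have hMpos : (0 : ℝ) < M :=
      lt_of_le_of_lt (Finset.sum_nonneg fun k _ => div_nonneg (abs_nonneg _) (hc k).le) hM
    have hstep : ∀ k, |α k| / M < c k := by
      intro k
      have : |α k| / c k < M := lt_of_le_of_lt
        (Finset.single_le_sum (f := fun k => |α k| / c k)
          (fun k _ => div_nonneg (abs_nonneg _) (hc k).le) (Finset.mem_univ k)) hM
      rw [div_lt_iff₀ (hc k)] at this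
      rw [div_lt_iff₀ hMpos]
      linarith
    have hj : ∀ j : ℕ, G.Reachable 0 (((j : ℝ) / M) • α) := by
      intro j
      induction j with
      | zero => simp
      | succ j ih =>
        refine ih.trans ?_
        by_cases heq : ((j : ℝ) / M) • α = (((j + 1 : ℕ) : ℝ) / M) • α
        · rw [heq]
        · refine SimpleGraph.Adj.reachable ⟨heq, 0, fun k => ?_⟩
          have e : ((((j + 1 : ℕ) : ℝ) / M) • α) k - (((j : ℝ) / M) • α) k -
              A.mulVec (fun l => ((0 : ι → ℤ) l : ℝ)) k = α k / M := by
            rw [hzero]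
            simp only [Pi.smul_apply, smul_eq_mul, Pi.zero_apply]
            push_cast
            ring
          rw [e, abs_div, abs_of_pos hMpos]
          exact hstep k
    simpa [div_self hMpos.ne'] using hj M
  obtain ⟨w, hw⟩ := hreach.exists_walk_length_eq_dist
  -- A geodesic admits no shortcut, so its even-indexed vertices are separated.
  have hshort : ∀ i j, i + 2 ≤ j → j ≤ w.length → ¬ near (w.getVert i) (w.getVert j) := by
    intro i j hij hjl hn
    by_cases heq : w.getVert i = w.getVert j
    · have := SimpleGraph.dist_le ((w.take i).append (((w.drop j).copy heq.symm rfl)))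
      simp at this
      omega
    · have hadj : G.Adj (w.getVert i) (w.getVert j) := ⟨heq, hn⟩
      have := SimpleGraph.dist_le ((w.take i).append (SimpleGraph.Walk.cons hadj (w.drop j)))
      simp at this
      omega
  have hpack := card_mul_prod_le_one_of_separated A hA c hc hmin (w.length / 2 + 1)
    (fun i => w.getVert (2 * i)) (by
      intro i j hij hn
      have hi := i.2
      have hj := j.2
      rcases lt_or_gt_of_ne (fun h => hij (Fin.ext h) : (i : ℕ) ≠ j) with h | h
      · exact hshort (2 * i) (2 * j) (by omega) (by omega) hn
      · exact hshort (2 * j) (2 * i) (by omega) (by omega) (hsymm _ _ hn))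
  have hprod : 0 < ∏ k, c k := Finset.prod_pos fun k _ => hc k
  have hlen : (w.length : ℝ) ≤ 2 / ∏ k, c k := by
    rw [le_div_iff₀ hprod]
    have h1 : (w.length : ℝ) ≤ 2 * ((w.length / 2 + 1 : ℕ) : ℝ) := by
      have : w.length ≤ 2 * (w.length / 2 + 1) := by omega
      exact_mod_cast this
    nlinarith
  obtain ⟨z, hz⟩ := hwalk _ _ w
  refine ⟨z, fun k => ?_⟩
  rw [abs_sub_comm]
  have := hz k
  simp only [Pi.zero_apply, sub_zero] at this
  exact this.trans (mul_le_mul_of_nonneg_right hlen (hc k).le)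

/-! ### Specialisation to the forms `x`, `Θ x - y` -/

theorem weightedNorm_le_iff {k : ℕ} {σ : Fin k → ℝ} (hσ : IsWeight σ) (x : Fin k → ℝ) {t : ℝ}
    (ht : 0 < t) : weightedNorm σ x ≤ t ↔ ∀ j, |x j| ≤ t ^ σ j := by
  have hiff : ∀ j, |x j| ^ (1 / σ j) ≤ t ↔ |x j| ≤ t ^ σ j := by
    intro j
    rw [one_div, Real.rpow_inv_le_iff_of_pos (abs_nonneg _) ht.le (hσ.pos j)]
  constructor
  · intro h j
    exact (hiff j).1 ((le_ciSup (f := fun j => |x j| ^ (1 / σ j))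
      (Set.finite_range _).bddAbove j).trans h)
  · intro h
    exact Real.iSup_le (fun j => (hiff j).2 (h j)) ht.le

/-- The matrix of the linear forms `(x, y) ↦ (x, Θ x - y)`. -/
def formMatrix {m n : ℕ} (Θ : Matrix (Fin n) (Fin m) ℝ) :
    Matrix (Fin m ⊕ Fin n) (Fin m ⊕ Fin n) ℝ :=
  Matrix.fromBlocks 1 0 Θ (-1)

theorem abs_det_formMatrix {m n : ℕ} (Θ : Matrix (Fin n) (Fin m) ℝ) :
    |(formMatrix Θ).det| = 1 := by
  rw [formMatrix, Matrix.det_fromBlocks_zero₁₂, Matrix.det_neg]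
  simp

theorem formMatrix_mulVec_inl {m n : ℕ} (Θ : Matrix (Fin n) (Fin m) ℝ)
    (z : Fin m ⊕ Fin n → ℤ) (j : Fin m) :
    (formMatrix Θ).mulVec (fun l => (z l : ℝ)) (Sum.inl j) = z (Sum.inl j) := by
  rw [formMatrix, Matrix.fromBlocks_mulVec]
  simp

theorem formMatrix_mulVec_inr {m n : ℕ} (Θ : Matrix (Fin n) (Fin m) ℝ)
    (z : Fin m ⊕ Fin n → ℤ) (i : Fin n) :
    (formMatrix Θ).mulVec (fun l => (z l : ℝ)) (Sum.inr i) =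
      Θ.mulVec (fun j => (z (Sum.inl j) : ℝ)) i - z (Sum.inr i) := by
  rw [formMatrix, Matrix.fromBlocks_mulVec]
  simp [Matrix.neg_mulVec, Function.comp_def, sub_eq_add_neg]

theorem forall_not_formMatrix_lt {m n : ℕ} {Θ : Matrix (Fin n) (Fin m) ℝ}
    {a : Fin m → ℝ} {b : Fin n → ℝ}
    (h : ¬ ∃ (x : Fin m → ℤ) (y : Fin n → ℤ), (x, y) ≠ 0 ∧ (∀ j, |(x j : ℝ)| < a j) ∧
      ∀ i, |Θ.mulVec (fun j => (x j : ℝ)) i - (y i : ℝ)| < b i)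
    (z : Fin m ⊕ Fin n → ℤ) (hz : z ≠ 0) :
    ¬ ∀ k, |(formMatrix Θ).mulVec (fun l => (z l : ℝ)) k| < Sum.elim a b k := by
  intro hlt
  refine h ⟨fun j => z (Sum.inl j), fun i => z (Sum.inr i), ?_, fun j => ?_, fun i => ?_⟩
  · intro h0
    rw [Prod.mk_eq_zero] at h0
    apply hz
    ext (j | i)
    · exact congrFun h0.1 j
    · exact congrFun h0.2 i
  · simpa [formMatrix_mulVec_inl] using hlt (Sum.inl j)
  · simpa [formMatrix_mulVec_inr] using hlt (Sum.inr i)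

/-- Minkowski's linear forms theorem, as the packing bound for a single box. -/
theorem exists_ne_zero_forall_abs_lt {m n : ℕ} (Θ : Matrix (Fin n) (Fin m) ℝ)
    (a : Fin m → ℝ) (b : Fin n → ℝ) (ha : ∀ j, 0 < a j) (hb : ∀ i, 0 < b i)
    (hab : 1 < (∏ j, a j) * ∏ i, b i) :
    ∃ (x : Fin m → ℤ) (y : Fin n → ℤ), (x, y) ≠ 0 ∧ (∀ j, |(x j : ℝ)| < a j) ∧
      ∀ i, |Θ.mulVec (fun j => (x j : ℝ)) i - (y i : ℝ)| < b i := by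
  by_contra h
  have := card_mul_prod_le_one_of_separated (formMatrix Θ) (abs_det_formMatrix Θ) (Sum.elim a b)
    (by rintro (j | i) <;> simp [ha, hb]) (forall_not_formMatrix_lt h) 1 (fun _ => 0)
    (fun i j hij => absurd (Subsingleton.elim i j) hij)
  simp only [Nat.cast_one, one_mul, Fintype.prod_sum_type, Sum.elim_inl, Sum.elim_inr] at this
  linarith

theorem exists_forall_abs_sub_le {m n : ℕ} (Θ : Matrix (Fin n) (Fin m) ℝ)
    (a : Fin m → ℝ) (b : Fin n → ℝ) (ha : ∀ j, 0 < a j) (hb : ∀ i, 0 < b i)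
    (h : ¬ ∃ (x : Fin m → ℤ) (y : Fin n → ℤ), (x, y) ≠ 0 ∧ (∀ j, |(x j : ℝ)| < a j) ∧
      ∀ i, |Θ.mulVec (fun j => (x j : ℝ)) i - (y i : ℝ)| < b i)
    (η : Fin n → ℝ) :
    ∃ (x : Fin m → ℤ) (y : Fin n → ℤ),
      (∀ j, |(x j : ℝ)| ≤ 2 / ((∏ j, a j) * ∏ i, b i) * a j) ∧
      ∀ i, |Θ.mulVec (fun j => (x j : ℝ)) i - (y i : ℝ) - η i| ≤
        2 / ((∏ j, a j) * ∏ i, b i) * b i := by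
  obtain ⟨z, hz⟩ := exists_int_forall_abs_sub_le (formMatrix Θ) (abs_det_formMatrix Θ)
    (Sum.elim a b) (by rintro (j | i) <;> simp [ha, hb]) (forall_not_formMatrix_lt h)
    (Sum.elim 0 η)
  refine ⟨fun j => z (Sum.inl j), fun i => z (Sum.inr i), fun j => ?_, fun i => ?_⟩
  · simpa [formMatrix_mulVec_inl] using hz (Sum.inl j)
  · simpa [formMatrix_mulVec_inr] using hz (Sum.inr i)

theorem IsWeight.prod_rpow {k : ℕ} {σ : Fin k → ℝ} (hσ : IsWeight σ) {t : ℝ} (ht : 0 < t) :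
    ∏ j, t ^ σ j = t := by
  rw [← Real.rpow_sum_of_pos ht, hσ.sum_eq_one, Real.rpow_one]

/-! ### Exponents and transference -/

theorem homogeneousSolvable_of_lt_one {m n : ℕ} {σ : Fin m → ℝ} {ρ : Fin n → ℝ}
    (hσ : IsWeight σ) (hρ : IsWeight ρ) (Θ : Matrix (Fin n) (Fin m) ℝ) {γ t : ℝ} (hγ : γ < 1)
    (ht : 1 < t) : HomogeneousSolvable σ ρ Θ γ t := by
  have ht0 : 0 < t := by linarith
  have hT : 0 < t ^ (-γ) := Real.rpow_pos_of_pos ht0 _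
  obtain ⟨x, y, hxy, hx, hy⟩ := exists_ne_zero_forall_abs_lt Θ (fun j => t ^ σ j)
    (fun i => (t ^ (-γ)) ^ ρ i) (fun j => Real.rpow_pos_of_pos ht0 _)
    (fun i => Real.rpow_pos_of_pos hT _) (by
      rw [hσ.prod_rpow ht0, hρ.prod_rpow hT, ← Real.rpow_one_add' ht0.le (by linarith)]
      exact Real.one_lt_rpow ht (by linarith))
  exact ⟨x, y, hxy, (weightedNorm_le_iff hσ _ ht0).2 fun j => (hx j).le,
    (weightedNorm_le_iff hρ _ hT).2 fun i => (hy i).le⟩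

theorem one_le_weightedExponent {m n : ℕ} {σ : Fin m → ℝ} {ρ : Fin n → ℝ}
    (hσ : IsWeight σ) (hρ : IsWeight ρ) (Θ : Matrix (Fin n) (Fin m) ℝ) :
    1 ≤ weightedExponent σ ρ Θ := by
  refine EReal.ge_of_forall_gt_iff_ge.1 fun γ hγ => ?_
  have hγ : γ < 1 := by exact_mod_cast hγ
  refine le_sSup ⟨γ, ?_, rfl⟩
  exact ((eventually_gt_atTop 1).mono fun t ht =>
    homogeneousSolvable_of_lt_one hσ hρ Θ hγ ht).frequently

theorem eventually_not_homogeneousSolvable {m n : ℕ} {σ : Fin m → ℝ} {ρ : Fin n → ℝ}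
    {Θ : Matrix (Fin n) (Fin m) ℝ} {γ : ℝ} (hγ : weightedExponent σ ρ Θ < γ) :
    ∀ᶠ t in atTop, ¬ HomogeneousSolvable σ ρ Θ γ t := by
  by_contra h
  exact hγ.not_ge (le_sSup ⟨γ, h, rfl⟩)

theorem inhomogeneous_of_not_homogeneousSolvable {m n : ℕ} {σ : Fin m → ℝ} {ρ : Fin n → ℝ}
    (hσ : IsWeight σ) (hρ : IsWeight ρ) {Θ : Matrix (Fin n) (Fin m) ℝ} {γ T : ℝ} (hT : 0 < T)
    (h : ¬ HomogeneousSolvable σ ρ Θ γ T) (η : Fin n → ℝ) :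
    ∃ (x : Fin m → ℤ) (y : Fin n → ℤ),
      (∀ j, |(x j : ℝ)| ≤ 2 * T ^ (γ - 1 + σ j)) ∧
      ∀ i, |Θ.mulVec (fun j => (x j : ℝ)) i - (y i : ℝ) - η i| ≤ 2 * T ^ (γ - 1 - γ * ρ i) := by
  have hT' : 0 < T ^ (-γ) := Real.rpow_pos_of_pos hT _
  obtain ⟨x, y, hx, hy⟩ := exists_forall_abs_sub_le Θ (fun j => T ^ σ j)
    (fun i => (T ^ (-γ)) ^ ρ i) (fun j => Real.rpow_pos_of_pos hT _)
    (fun i => Real.rpow_pos_of_pos hT' _) (by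
      rintro ⟨x, y, hxy, hx, hy⟩
      exact h ⟨x, y, hxy, (weightedNorm_le_iff hσ _ hT).2 fun j => (hx j).le,
        (weightedNorm_le_iff hρ _ hT').2 fun i => (hy i).le⟩) η
  have hprod : 2 / ((∏ j, T ^ σ j) * ∏ i, (T ^ (-γ)) ^ ρ i) = 2 * T ^ (γ - 1) := by
    rw [hσ.prod_rpow hT, hρ.prod_rpow hT', Real.rpow_neg hT.le, Real.rpow_sub_one hT.ne']
    field_simp
  rw [hprod] at hx hy
  refine ⟨x, y, fun j => (hx j).trans_eq ?_, fun i => (hy i).trans_eq ?_⟩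
  · rw [mul_assoc, ← Real.rpow_add hT]
  · rw [mul_assoc, ← Real.rpow_mul hT.le, ← Real.rpow_add hT]
    ring_nf

theorem eventually_two_mul_rpow_le {a b : ℝ} (hab : a < b) :
    ∀ᶠ t : ℝ in atTop, 2 * t ^ a ≤ t ^ b := by
  filter_upwards [(tendsto_rpow_atTop (sub_pos.2 hab)).eventually_ge_atTop 2,
    eventually_gt_atTop 0] with t ht ht0
  calc 2 * t ^ a ≤ t ^ (b - a) * t ^ a :=
        mul_le_mul_of_nonneg_right ht (Real.rpow_nonneg ht0.le _)
    _ = t ^ b := by rw [← Real.rpow_add ht0]; ring_nf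

theorem eventually_not_forall_abs_le_of_ne_zero {n : ℕ} {ρ : Fin n → ℝ} (hρ : IsWeight ρ)
    {η : Fin n → ℝ} (hη : η ≠ 0) {δ : ℝ} (hδ : 0 < δ) :
    ∀ᶠ t : ℝ in atTop, ¬ ∀ i, |η i| ≤ (t ^ (-δ)) ^ ρ i := by
  obtain ⟨i, hi⟩ := Function.ne_iff.1 hη
  have h0 : 0 < |η i| := abs_pos.2 hi
  filter_upwards [(tendsto_rpow_neg_atTop (mul_pos hδ (hρ.pos i))).eventually_lt_const h0,
    eventually_gt_atTop 0] with t ht ht0 hall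
  have := hall i
  rw [← Real.rpow_mul ht0.le, neg_mul] at this
  linarith

theorem eventually_inhomogeneousSolvable {m n : ℕ} {σ : Fin m → ℝ} {ρ : Fin n → ℝ}
    (hσ : IsWeight σ) (hρ : IsWeight ρ) {Θ : Matrix (Fin n) (Fin m) ℝ} {γ s δ : ℝ}
    (hγ : weightedExponent σ ρ Θ < γ) (hs : 0 < s) (hδ : 0 < δ) (hδ1 : δ < 1)
    (hsσ : ∀ j, s * (γ - 1 + σ j) < σ j)
    (hsρ : ∀ i, s * (γ - 1 - γ * ρ i) < -δ * ρ i) (η : Fin n → ℝ) :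
    ∀ᶠ t in atTop, InhomogeneousSolvable σ ρ Θ η δ t := by
  -- Covering may return the zero pair. For `η ≠ 0` it fails for large `t`; for `η = 0` Minkowski's
  -- theorem replaces covering, whence `δ < 1`.
  by_cases hη : η = 0
  · subst hη
    filter_upwards [eventually_gt_atTop 1] with t ht
    simpa [InhomogeneousSolvable, HomogeneousSolvable] using
      homogeneousSolvable_of_lt_one hσ hρ Θ hδ1 ht
  · filter_upwards [(tendsto_rpow_atTop hs).eventually (eventually_not_homogeneousSolvable hγ),
      eventually_gt_atTop 0, eventually_not_forall_abs_le_of_ne_zero hρ hη hδ,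
      eventually_all.2 fun j => eventually_two_mul_rpow_le (hsσ j),
      eventually_all.2 fun i => eventually_two_mul_rpow_le (hsρ i)] with t ht ht0 hηt htσ htρ
    obtain ⟨x, y, hx, hy⟩ := inhomogeneous_of_not_homogeneousSolvable hσ hρ
      (Real.rpow_pos_of_pos ht0 s) ht η
    have hy' : ∀ i, |Θ.mulVec (fun j => (x j : ℝ)) i - (y i : ℝ) - η i| ≤ (t ^ (-δ)) ^ ρ i := by
      intro i
      refine (hy i).trans ?_
      rw [← Real.rpow_mul ht0.le, ← Real.rpow_mul ht0.le]
      exact htρ i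
    refine ⟨x, y, ?_, (weightedNorm_le_iff hσ _ ht0).2 fun j => (hx j).trans ?_,
      (weightedNorm_le_iff hρ _ (Real.rpow_pos_of_pos ht0 _)).2 hy'⟩
    · intro h0
      rw [Prod.mk_eq_zero] at h0
      obtain ⟨rfl, rfl⟩ := h0
      apply hηt
      intro i
      have h0 : Θ.mulVec (fun _ => (0 : ℝ)) i = 0 := congrFun (Matrix.mulVec_zero Θ) i
      simpa [h0] using hy' i
    · rw [← Real.rpow_mul ht0.le]
      exact htσ j

theorem theoremt {m n : ℕ} (hm : 0 < m) (hn : 0 < n)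
    (σ : Fin m → ℝ) (ρ : Fin n → ℝ) (hσ : IsWeight σ) (hρ : IsWeight ρ)
    (Θ : Matrix (Fin n) (Fin m) ℝ) (σm ρn : ℝ)
    (hσm : σm = σ ⟨m - 1, Nat.sub_one_lt_of_lt hm⟩)
    (hρn : ρn = ρ ⟨n - 1, Nat.sub_one_lt_of_lt hn⟩)
    (hω : weightedExponent σ ρ Θ < invOneSub ρn) :
    ∀ η : Fin n → ℝ,
      ((σm / ρn * ((1 - (1 - ρn) * (weightedExponent σ ρ Θ).toReal) /
          ((weightedExponent σ ρ Θ).toReal - (1 - σm))) : ℝ) : EReal)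
        ≤ uniformInhomogeneousExponent σ ρ Θ η := by
  intro η
  have hσm0 : 0 < σm := hσm ▸ hσ.pos _
  have hρn0 : 0 < ρn := hρn ▸ hρ.pos _
  have hσle : ∀ j, σm ≤ σ j := fun j => hσm ▸ hσ.antitone (Fin.mk_le_mk.2 (by omega))
  have hρle : ∀ i, ρn ≤ ρ i := fun i => hρn ▸ hρ.antitone (Fin.mk_le_mk.2 (by omega))
  have hρn1 : ρn ≤ 1 := by
    rw [hρn, ← hρ.sum_eq_one]
    exact Finset.single_le_sum (fun i _ => (hρ.pos i).le) (Finset.mem_univ _)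
  have hone := one_le_weightedExponent hσ hρ Θ
  have hcoe : ((weightedExponent σ ρ Θ).toReal : EReal) = weightedExponent σ ρ Θ := by
    refine EReal.coe_toReal (ne_top_of_lt hω) ?_
    intro h
    rw [h] at hone
    exact (EReal.bot_lt_coe 1).not_ge hone
  set w := (weightedExponent σ ρ Θ).toReal with hw
  rw [← hcoe] at hone hω
  have hw1 : 1 ≤ w := by exact_mod_cast hone
  have hnum : 0 < 1 - (1 - ρn) * w := by
    by_cases h1 : ρn = 1
    · simp [h1]
    · have hpos : 0 < 1 - ρn := sub_pos.2 (lt_of_le_of_ne hρn1 h1)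
      rw [invOneSub, if_neg h1, EReal.coe_lt_coe_iff, ← one_div,
        lt_div_iff₀ hpos] at hω
      linarith
  set β : ℝ → ℝ := fun γ => σm / ρn * ((1 - (1 - ρn) * γ) / (γ - (1 - σm))) with hβ
  have hβw : 0 < β w := mul_pos (div_pos hσm0 hρn0) (div_pos hnum (by linarith))
  have hβcont : ContinuousAt β w := by
    refine ContinuousAt.mul continuousAt_const (ContinuousAt.div ?_ ?_ (by linarith)) <;> fun_prop
  refine EReal.ge_of_forall_gt_iff_ge.1 fun δ₀ hδ₀ => ?_
  have hδ₀ : δ₀ < β w := by exact_mod_cast hδ₀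
  obtain ⟨δ, hδlow, hδβ⟩ := exists_between (max_lt hδ₀ hβw)
  have hδ : 0 < δ := (le_max_right _ _).trans_lt hδlow
  obtain ⟨γ, hγβ, hγw⟩ := (((hβcont.tendsto.mono_left nhdsWithin_le_nhds).eventually_const_lt
    hδβ).and (self_mem_nhdsWithin (s := Set.Ioi w))).exists
  have hγw : w < γ := hγw
  have hden : 0 < γ - (1 - σm) := by linarith
  have hγnum : 0 < 1 - (1 - ρn) * γ := by
    have h1 : 0 < β γ := hδ.trans hγβ
    have h2 := (mul_pos_iff_of_pos_left (div_pos hσm0 hρn0)).1 h1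
    exact (div_pos_iff_of_pos_right hden).1 h2
  -- The two bounds are the coordinate conditions for `ρn` and `σm`; they are compatible exactly
  -- when `δ < β γ`.
  obtain ⟨s, hs1, hs2⟩ : ∃ s, δ * ρn / (1 - (1 - ρn) * γ) < s ∧ s < σm / (γ - (1 - σm)) := by
    apply exists_between
    rw [div_lt_div_iff₀ hγnum hden]
    simp only [hβ] at hγβ
    rw [div_mul_div_comm, lt_div_iff₀ (mul_pos hρn0 hden)] at hγβ
    linarith
  rw [div_lt_iff₀ hγnum] at hs1
  rw [lt_div_iff₀ hden] at hs2
  have hs : 0 < s := by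
    by_contra! h
    nlinarith [mul_pos hδ hρn0]
  have hs_lt_one : s < 1 := by
    by_contra! h
    nlinarith
  have hδ1 : δ < 1 := by
    by_contra! h
    nlinarith [mul_nonneg (sub_nonneg.2 hρn1) (sub_nonneg.2 (hw1.trans hγw.le))]
  refine (EReal.coe_le_coe_iff.2 ((le_max_left _ _).trans hδlow.le)).trans (le_sSup ⟨δ, ?_, rfl⟩)
  refine eventually_inhomogeneousSolvable hσ hρ (γ := γ) (s := s) ?_ hs hδ hδ1 ?_ ?_ η
  · rw [← hcoe]
    exact_mod_cast hγw
  · intro j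
    -- As `s < 1`, the slack grows with `σ j`; below, as `δ < s * γ`, it grows with `ρ i`.
    nlinarith [mul_nonneg (sub_nonneg.2 hs_lt_one.le) (sub_nonneg.2 (hσle j))]
  · intro i
    have h1 : 0 < s * γ - δ := by
      nlinarith [mul_nonneg hs.le (sub_nonneg.2 (hw1.trans hγw.le))]
    nlinarith [mul_nonneg h1.le (sub_nonneg.2 (hρle i))]
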